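/- Let $\gamma>0$, let $n\ge 1$ be an integer, and let $g(t)=\sqrt{2\gamma}\,e^{-\gamma t}\chi_{(0,\infty)}(t)$ be the one-sided exponential. For $a,b>0$ consider the Gabor system $\mathcal G(g,a\mathbb Z\times b\mathbb Z)=\{\,t\mapsto g(t-x)e^{2\pi i\omega t} : (x,\omega)\in a\mathbb Z\times b\mathbb Z\,\}$ in $L^2(\mathbb R)$. Let $A(a,b)$ be the largest and $B(a,b)$ the smallest constant such that $$A(a,b)\,\|f\|_2^2\le\sum_{(x,\omega)\in a\mathbb Z\times b\mathbb Z}\Big|\int_{\mathbb R} f(t)\,\overline{g(t-x)}\,e^{-2\pi i\omega t}\,dt\Big|^2\le B(a,b)\,\|f\|_2^2\qquad\text{for all } f\in L^2(\mathbb R),$$ and let $\kappa(a,b)=B(a,b)/A(a,b)$ be the frame condition number. Then, among all rectangular lattices $a\mathbb Z\times b\mathbb Z$ with $a,b>0$ and $(ab)^{-1}=n$, the Gabor system is always a frame (that is, $0<A(a,b)\le B(a,b)<\infty$), and the following hold. 1. The condition number $\kappa$ is minimal for the lattice $(a_0/n)\mathbb Z\times(1/a_0)\mathbb Z$ with $a_0=\operatorname{arcsinh}(n)/\gamma$,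 and for no other lattice. 2. The lower frame bound $A$ has a unique maximizing lattice, and it is of the form $(a_+/n)\mathbb Z\times(1/a_+)\mathbb Z$ with $0<a_+<\operatorname{arcsinh}(n)/\gamma$. 3. The upper frame bound $B$ has a unique minimizing lattice, and it is of the form $(a^- /n)\mathbb Z\times(1/a^-)\mathbb Z$ with $a^->\operatorname{arcsinh}(n)/\gamma$. -/

import Mathlib

open MeasureTheory
open scoped ENNReal

noncomputable section

namespace Gabor

/-- The rectangular lattice `aℤ × bℤ` in the time-frequency plane. -/
def rectLattice (a b : ℝ) : Set (ℝ × ℝ) :=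
  Set.range (fun k : ℤ => a * (k : ℝ)) ×ˢ Set.range (fun l : ℤ => b * (l : ℝ))

/-- The time-frequency shift `π(x, ω) g (t) = g (t - x) e^{2 π i ω t}`. -/
def timeFreqShift (p : ℝ × ℝ) (g : ℝ → ℂ) (t : ℝ) : ℂ :=
  g (t - p.1) * Complex.exp (2 * Real.pi * Complex.I * p.2 * t)

/-- The `L²(ℝ)` inner product `⟨f, h⟩ = ∫ f(t) conj(h(t)) dt`, linear in the first argument. -/
def innerL2 (f h : ℝ → ℂ) : ℂ :=
  ∫ t : ℝ, f t * starRingEnd ℂ (h t)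

/-- The sum `∑_{p ∈ Λ} |⟨f, π(p) g⟩|²`, with values in `[0, ∞]`. -/
def frameSum (g : ℝ → ℂ) (Λ : Set (ℝ × ℝ)) (f : ℝ → ℂ) : ℝ≥0∞ :=
  ∑' p : Λ, ‖innerL2 f (timeFreqShift (p : ℝ × ℝ) g)‖ₑ ^ 2

/-- `A ‖f‖² ≤ ∑_{p ∈ Λ} |⟨f, π(p) g⟩|²` for all `f ∈ L²(ℝ)`. -/
def IsLowerBound (g : ℝ → ℂ) (Λ : Set (ℝ × ℝ)) (A : ℝ≥0∞) : Prop :=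
  ∀ f : ℝ → ℂ, MemLp f 2 volume → A * eLpNorm f 2 volume ^ 2 ≤ frameSum g Λ f

/-- `∑_{p ∈ Λ} |⟨f, π(p) g⟩|² ≤ B ‖f‖²` for all `f ∈ L²(ℝ)`. -/
def IsUpperBound (g : ℝ → ℂ) (Λ : Set (ℝ × ℝ)) (B : ℝ≥0∞) : Prop :=
  ∀ f : ℝ → ℂ, MemLp f 2 volume → frameSum g Λ f ≤ B * eLpNorm f 2 volume ^ 2

/-- The Gabor system `{π(p) g : p ∈ Λ}` is a frame for `L²(ℝ)`. -/
def IsFrame (g : ℝ → ℂ) (Λ : Set (ℝ × ℝ)) : Prop :=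
  ∃ A B : ℝ≥0∞, 0 < A ∧ A ≤ B ∧ B < ∞ ∧ IsLowerBound g Λ A ∧ IsUpperBound g Λ B

/-- The sharp (largest) lower frame bound. -/
def lowerFrameBound (g : ℝ → ℂ) (Λ : Set (ℝ × ℝ)) : ℝ≥0∞ :=
  sSup {A : ℝ≥0∞ | IsLowerBound g Λ A}

/-- The sharp (smallest) upper frame bound. -/
def upperFrameBound (g : ℝ → ℂ) (Λ : Set (ℝ × ℝ)) : ℝ≥0∞ :=
  sInf {B : ℝ≥0∞ | IsUpperBound g Λ B}

/-- The frame condition number: the ratio of the sharp upper and lower frame bounds. -/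
def condNumber (g : ℝ → ℂ) (Λ : Set (ℝ × ℝ)) : ℝ≥0∞ :=
  upperFrameBound g Λ / lowerFrameBound g Λ

/-- The one-sided exponential `√(2γ) e^{-γ t} χ_{(0,∞)}(t)`. -/
def oneSidedExp (γ : ℝ) : ℝ → ℂ :=
  Set.indicator (Set.Ioi 0) (fun t : ℝ => ((Real.sqrt (2 * γ) * Real.exp (-γ * t) : ℝ) : ℂ))

end Gabor

end

/-! Put `T = n a = 1 / b` and `ρ = e^{-γT}`. Every `f ∈ L²` is `G - ρ G(· + T)` for some `G ∈ L²`.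
The exponential decay of the window matches `ρ`, so the inner product of `f` with a time-frequency
shift of the window telescopes to an integral of `G` over one interval of length `T`. Parseval in
frequency and summation over the time shifts then give the frame sum as `∫ W |G|²`, where `W` has
period `a` (`frameSum_dampedDiff`).

The bounds follow from the range of `W` and from `(1 - ρ)‖G‖ ≤ ‖f‖ ≤ (1 + ρ)‖G‖`. They are sharp
because `T` is a multiple of `a`: long trains of bumps with step `T` keep `G` where `W` is nearly
extremal, while their signs make `‖f‖` nearly extremal at the same time (`exists_frameSum_near`).

With `u = γ n a` and `k = 2 / n` this reads `A = 2u tanh(u/2) e^{-ku} / (1 - e^{-ku})` and `B = 2u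
coth(u/2) / (1 - e^{-ku})`. The logarithmic slopes in `u` of `A`, `B` and `B / A` are strictly
monotone, so each extremum is unique. That of `B / A` is `2u/n - 2u/sinh u`, with zero `u = arsinh
n`. There the slopes of `A` and `B` agree and are negative, so `A` peaks earlier and `B` bottoms out
later. -/

noncomputable section

namespace Gabor

/-! ### Inverting a damped translation on `L²` -/

/-- The operator `G ↦ G - ρ G(· + T)`. -/
def dampedDiff (ρ T : ℝ) (G : ℝ → ℂ) (t : ℝ) : ℂ :=
  G t - ρ * G (t + T)

lemma memLp_translate {G : ℝ → ℂ} (hG : MemLp G 2 volume) (T : ℝ) :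
    MemLp (fun t => G (t + T)) 2 volume :=
  hG.comp_measurePreserving (measurePreserving_add_right volume T)

lemma eLpNorm_translate {G : ℝ → ℂ} (hG : MemLp G 2 volume) (T : ℝ) :
    eLpNorm (fun t => G (t + T)) 2 volume = eLpNorm G 2 volume :=
  eLpNorm_comp_measurePreserving hG.1 (measurePreserving_add_right volume T)

lemma memLp_dampedDiff {G : ℝ → ℂ} (hG : MemLp G 2 volume) (ρ T : ℝ) :
    MemLp (dampedDiff ρ T G) 2 volume :=
  hG.sub ((memLp_translate hG T).const_mul _)

/-- Inversion of `dampedDiff` on `L²` by a Neumann series. -/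
lemma exists_dampedDiff_ae_eq {ρ : ℝ} (h0 : 0 ≤ ρ) (h1 : ρ < 1) (T : ℝ) {f : ℝ → ℂ}
    (hf : MemLp f 2 volume) :
    ∃ G : ℝ → ℂ, MemLp G 2 volume ∧ f =ᵐ[volume] dampedDiff ρ T G := by
  have hmp := measurePreserving_add_right (volume : Measure ℝ) T
  let U : Lp ℂ 2 (volume : Measure ℝ) →L[ℂ] Lp ℂ 2 (volume : Measure ℝ) :=
    (Lp.compMeasurePreservingₗᵢ ℂ (fun t : ℝ => t + T) hmp).toContinuousLinearMap
  have hU : ‖U‖ ≤ 1 := LinearIsometry.norm_toContinuousLinearMap_le _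
  have hnorm : ‖(ρ : ℂ) • U‖ < 1 := by
    rw [norm_smul, Complex.norm_real, Real.norm_of_nonneg h0]
    nlinarith [norm_nonneg U]
  obtain ⟨V, hV⟩ := isUnit_one_sub_of_norm_lt_one hnorm
  let G : Lp ℂ 2 (volume : Measure ℝ) := (↑V⁻¹ : _ →L[ℂ] _) hf.toLp
  have hG : G - (ρ : ℂ) • U G = hf.toLp := by
    have h : (V : Lp ℂ 2 (volume : Measure ℝ) →L[ℂ] Lp ℂ 2 (volume : Measure ℝ)) G = hf.toLp := by
      change ((V : Lp ℂ 2 (volume : Measure ℝ) →L[ℂ] Lp ℂ 2 (volume : Measure ℝ)) *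
        (↑V⁻¹ : Lp ℂ 2 (volume : Measure ℝ) →L[ℂ] Lp ℂ 2 (volume : Measure ℝ))) hf.toLp = _
      rw [Units.mul_inv]; rfl
    rw [hV] at h
    exact h
  refine ⟨G, Lp.memLp G, ?_⟩
  have hUG : (U G : ℝ → ℂ) =ᵐ[volume] (G : ℝ → ℂ) ∘ fun t => t + T :=
    Lp.coeFn_compMeasurePreserving G hmp
  have hsub := Lp.coeFn_sub G ((ρ : ℂ) • U G)
  rw [hG] at hsub
  filter_upwards [hf.coeFn_toLp, hsub, Lp.coeFn_smul (ρ : ℂ) (U G), hUG] with t e1 e2 e3 e4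
  rw [← e1, e2, Pi.sub_apply, e3, Pi.smul_apply, e4]
  rfl

/-! ### The frame sum as a weighted `L²` norm -/

lemma innerL2_congr {f f' : ℝ → ℂ} (h : f =ᵐ[volume] f') (g : ℝ → ℂ) :
    innerL2 f g = innerL2 f' g := by
  refine integral_congr_ae ?_
  filter_upwards [h] with t ht
  rw [ht]

lemma frameSum_congr {f f' : ℝ → ℂ} (h : f =ᵐ[volume] f') (g : ℝ → ℂ) (Λ : Set (ℝ × ℝ)) :
    frameSum g Λ f = frameSum g Λ f' := by
  simp only [frameSum, innerL2_congr h]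

lemma frameSum_rectLattice (g f : ℝ → ℂ) {a b : ℝ} (ha : a ≠ 0) (hb : b ≠ 0) :
    frameSum g (rectLattice a b) f =
      ∑' k : ℤ, ∑' l : ℤ, ‖innerL2 f (timeFreqShift (a * k, b * l) g)‖ₑ ^ 2 := by
  have hinj : Function.Injective (fun p : ℤ × ℤ => ((a * p.1, b * p.2) : ℝ × ℝ)) := by
    rintro ⟨k, l⟩ ⟨k', l'⟩ h
    simpa [ha, hb] using h
  have hrange : rectLattice a b = Set.range (fun p : ℤ × ℤ => ((a * p.1, b * p.2) : ℝ × ℝ)) := by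
    rw [rectLattice, Set.prod_range_range_eq]
  rw [frameSum, hrange, tsum_range (fun p => ‖innerL2 f (timeFreqShift p g)‖ₑ ^ 2) hinj,
    ENNReal.tsum_prod']

/-- Parseval's identity on an interval of length `T`. -/
lemma tsum_enorm_sq_integral_mul_exp {T : ℝ} (hT : 0 < T) (x : ℝ) {H : ℝ → ℂ}
    (hH : MemLp H 2 (volume.restrict (Set.Ioc x (x + T)))) :
    ∑' l : ℤ, ‖∫ t in Set.Ioc x (x + T),
        H t * Complex.exp (-(2 * Real.pi * Complex.I * (1 / T * l : ℝ) * t))‖ₑ ^ 2 =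
      ENNReal.ofReal T * ∫⁻ t in Set.Ioc x (x + T), ‖H t‖ₑ ^ 2 := by
  have hlt : x < x + T := by linarith
  have key : ∀ l : ℤ, ∫ t in Set.Ioc x (x + T),
      H t * Complex.exp (-(2 * Real.pi * Complex.I * (1 / T * l : ℝ) * t)) =
        (T : ℂ) * fourierCoeffOn hlt H l := by
    intro l
    rw [fourierCoeffOn_eq_integral, intervalIntegral.integral_of_le hlt.le, add_sub_cancel_left,
      Complex.real_smul, ← mul_assoc]
    have : (T : ℂ) * ((1 / T : ℝ) : ℂ) = 1 := by
      rw [← Complex.ofReal_mul, mul_one_div_cancel hT.ne', Complex.ofReal_one]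
    rw [this, one_mul]
    refine integral_congr_ae (Filter.Eventually.of_forall fun t => ?_)
    simp only [fourier_coe_apply, smul_eq_mul]
    rw [mul_comm]
    congr 2
    push_cast
    ring
  have hs := hasSum_sq_fourierCoeffOn hlt hH
  have hint : ENNReal.ofReal (∫ t in x..x + T, ‖H t‖ ^ 2) =
      ∫⁻ t in Set.Ioc x (x + T), ‖H t‖ₑ ^ 2 := by
    rw [intervalIntegral.integral_of_le hlt.le,
      ofReal_integral_eq_lintegral_ofReal hH.integrable_norm_pow'
        (Filter.Eventually.of_forall fun _ => by positivity)]
    refine lintegral_congr fun t => ?_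
    rw [ENNReal.ofReal_pow (norm_nonneg _), ofReal_norm]
  have henorm : ∀ l : ℤ, ‖(T : ℂ) * fourierCoeffOn hlt H l‖ₑ ^ 2 =
      ENNReal.ofReal (T ^ 2) * ENNReal.ofReal (‖fourierCoeffOn hlt H l‖ ^ 2) := by
    intro l
    rw [enorm_mul, mul_pow, ENNReal.ofReal_pow (norm_nonneg _), ofReal_norm,
      ENNReal.ofReal_pow hT.le, ← ofReal_norm (T : ℂ), Complex.norm_real,
      Real.norm_of_nonneg hT.le]
  simp_rw [key, henorm]
  rw [ENNReal.tsum_mul_left, ← ENNReal.ofReal_tsum_of_nonneg (fun _ => by positivity) hs.summable,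
    hs.tsum_eq, ← ENNReal.ofReal_mul (by positivity), ← hint, ← ENNReal.ofReal_mul hT.le]
  congr 1
  rw [add_sub_cancel_left, smul_eq_mul]
  field_simp

/-- For `f = G - ρ G(· + T)` the inner products with shifts of the one-sided exponential only see
`G` on one period. -/
lemma innerL2_dampedDiff {γ T : ℝ} (hγ : 0 < γ) (hT : 0 < T) {G : ℝ → ℂ}
    (hG : MemLp G 2 volume) (x : ℝ) (l : ℤ) :
    innerL2 (dampedDiff (Real.exp (-γ * T)) T G) (timeFreqShift (x, 1 / T * l) (oneSidedExp γ)) =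
      ∫ t in Set.Ioc x (x + T), (G t * (Real.sqrt (2 * γ) * Real.exp (-γ * (t - x)) : ℝ)) *
        Complex.exp (-(2 * Real.pi * Complex.I * (1 / T * l : ℝ) * t)) := by
  set φ : ℝ → ℂ := fun t => (Real.sqrt (2 * γ) * Real.exp (-γ * (t - x)) : ℝ) *
    Complex.exp (-(2 * Real.pi * Complex.I * (1 / T * l : ℝ) * t)) with hφ
  have hφc : Continuous φ := by fun_prop
  have hφn : ∀ t, ‖φ t‖ ^ 2 = 2 * γ * Real.exp (2 * γ * x) * Real.exp (-(2 * γ) * t) := by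
    intro t
    have h1 : ‖Complex.exp (-(2 * Real.pi * Complex.I * (1 / T * l : ℝ) * t))‖ = 1 := by
      rw [Complex.norm_exp, Real.exp_eq_one_iff]
      simp
    rw [hφ]
    simp only [norm_mul, h1, mul_one]
    rw [Complex.norm_real, Real.norm_of_nonneg (by positivity), mul_pow,
      Real.sq_sqrt (by positivity), ← Real.exp_nat_mul, mul_assoc (2 * γ), ← Real.exp_add]
    congr 2
    push_cast
    ring
  have hφL : MemLp φ 2 (volume.restrict (Set.Ioi x)) := by
    rw [memLp_two_iff_integrable_sq_norm hφc.aestronglyMeasurable]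
    simp_rw [hφn]
    exact (integrableOn_exp_mul_Ioi (by linarith) x).const_mul _
  -- The frequencies `l / T` are `T`-periodic characters, so a shift by `T` only costs the decay
  -- factor. Hence `ρ G(t + T) φ(t) = G(t + T) φ(t + T)`, and the two half-line integrals cancel
  -- beyond `x + T`.
  have hφT : ∀ t, φ (t + T) = Real.exp (-γ * T) * φ t := by
    intro t
    simp only [hφ]
    have h1 : Real.exp (-γ * (t + T - x)) = Real.exp (-γ * T) * Real.exp (-γ * (t - x)) := by
      rw [← Real.exp_add]; congr 1; ring
    have h2 : Complex.exp (-(2 * Real.pi * Complex.I * (1 / T * l : ℝ) * (t + T : ℝ))) =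
        Complex.exp (-(2 * Real.pi * Complex.I * (1 / T * l : ℝ) * t)) := by
      rw [Complex.exp_eq_exp_iff_exists_int]
      refine ⟨-l, ?_⟩
      have : (T : ℂ) ≠ 0 := by exact_mod_cast hT.ne'
      push_cast
      field_simp
      ring
    rw [h1, h2]
    push_cast
    ring
  have hint : IntegrableOn (fun t => G t * φ t) (Set.Ioi x) :=
    MemLp.integrable_mul (hG.restrict _) hφL
  have hint' : IntegrableOn (fun t => G (t + T) * φ (t + T)) (Set.Ioi x) := by
    have : IntegrableOn (fun t => Real.exp (-γ * T) * (G (t + T) * φ t)) (Set.Ioi x) :=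
      (MemLp.integrable_mul ((memLp_translate hG T).restrict _) hφL).const_mul _
    refine this.congr (Filter.Eventually.of_forall fun t => ?_)
    simp only [hφT]
    ring
  have hstep : innerL2 (dampedDiff (Real.exp (-γ * T)) T G)
      (timeFreqShift (x, 1 / T * l) (oneSidedExp γ)) =
        ∫ t in Set.Ioi x, (G t * φ t - G (t + T) * φ (t + T)) := by
    rw [innerL2, ← integral_indicator measurableSet_Ioi]
    refine integral_congr_ae (Filter.Eventually.of_forall fun t => ?_)
    by_cases ht : x < t
    · have h1 : t ∈ Set.Ioi x := ht
      have h2 : t - x ∈ Set.Ioi (0 : ℝ) := sub_pos.2 ht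
      simp only [Set.indicator_of_mem h1, timeFreqShift, oneSidedExp, Set.indicator_of_mem h2,
        dampedDiff, hφT, map_mul, Complex.conj_ofReal, ← Complex.exp_conj]
      simp only [hφ, Complex.conj_I, map_ofNat]
      rw [show 2 * (Real.pi : ℂ) * -Complex.I * ((1 / T * l : ℝ) : ℂ) * t =
        -(2 * Real.pi * Complex.I * (1 / T * l : ℝ) * t) by ring]
      ring
    · have h1 : t ∉ Set.Ioi x := ht
      have h2 : t - x ∉ Set.Ioi (0 : ℝ) := fun h => ht (sub_pos.1 h)
      simp [Set.indicator_of_notMem h1, timeFreqShift, oneSidedExp, Set.indicator_of_notMem h2]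
  have hshift : ∫ t in Set.Ioi x, G (t + T) * φ (t + T) = ∫ t in Set.Ioi (x + T), G t * φ t := by
    have := (measurePreserving_add_right (volume : Measure ℝ) T).setIntegral_preimage_emb
      (measurableEmbedding_addRight T) (fun t => G t * φ t) (Set.Ioi (x + T))
    rw [← this]
    congr 2
    ext t
    simp
  have hsplit : ∫ t in Set.Ioi x, G t * φ t =
      (∫ t in Set.Ioc x (x + T), G t * φ t) + ∫ t in Set.Ioi (x + T), G t * φ t := by
    have hle : x ≤ x + T := by linarith
    rw [← setIntegral_union (Set.Ioc_disjoint_Ioi le_rfl) measurableSet_Ioi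
      (hint.mono_set Set.Ioc_subset_Ioi_self) (hint.mono_set (Set.Ioi_subset_Ioi hle)),
      Set.Ioc_union_Ioi_eq_Ioi hle]
  rw [hstep, integral_sub hint hint', hshift, hsplit, add_sub_cancel_right]
  refine integral_congr_ae (Filter.Eventually.of_forall fun t => ?_)
  simp only [hφ]
  ring

/-- The partial geometric sum `∑_{i < n} e^{-2γ i a}`. -/
def expSum (γ a : ℝ) (n : ℕ) : ℝ :=
  ∑ i ∈ Finset.range n, Real.exp (-(2 * γ) * (i * a))

/-- The periodic weight `t ↦ 2γ n a ∑_{i < n} e^{-2γ (t + i a)}`, `t ∈ (0, a]`. -/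
def periodicWeight (γ : ℝ) {a : ℝ} (ha : 0 < a) (n : ℕ) (t : ℝ) : ℝ :=
  n * a * (2 * γ) * expSum γ a n * Real.exp (-(2 * γ) * toIocMod ha 0 t)

/-- A point `t = s + j a` with `s ∈ (0, a]` lies in exactly `n` of the windows `(ak, ak + na]`,
those with `k = j, j - 1, …, j - n + 1`; the window `k = j - i` contributes `e^{-2γ(s + ia)}`. -/
lemma tsum_indicator_exp {γ a : ℝ} (hγ : 0 < γ) (ha : 0 < a) (n : ℕ) (t : ℝ) :
    ∑' k : ℤ, (Set.Ioc (a * k) (a * k + n * a)).indicator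
      (fun t : ℝ => ENNReal.ofReal (n * a * (2 * γ * Real.exp (-(2 * γ) * (t - a * k))))) t =
      ENNReal.ofReal (periodicWeight γ ha n t) := by
  set j : ℤ := toIocDiv ha 0 t with hj
  set s : ℝ := toIocMod ha 0 t with hs
  have ht : t = s + j * a := by
    have := toIocMod_add_toIocDiv_zsmul ha 0 t
    rw [zsmul_eq_mul] at this
    exact this.symm
  have hs0 : 0 < s := left_lt_toIocMod ha 0 t
  have hsa : s ≤ a := by simpa using toIocMod_le_right ha 0 t
  let e : ℕ ↪ ℤ := ⟨fun i => j - i, fun i i' h => by simpa using h⟩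
  have he : ∀ i : ℕ, (e i : ℝ) = j - i := by
    intro i
    change ((j - (i : ℤ) : ℤ) : ℝ) = j - i
    push_cast
    rfl
  rw [tsum_eq_sum (s := (Finset.range n).map e), Finset.sum_map]
  · have hmem : ∀ i ∈ Finset.range n,
        t ∈ Set.Ioc (a * (e i : ℝ)) (a * (e i : ℝ) + n * a) := by
      intro i hi
      have h1 : ((i : ℝ) + 1) * a ≤ n * a := by
        gcongr
        exact_mod_cast Finset.mem_range.1 hi
      have h2 := he i
      have h3 : 0 ≤ (i : ℝ) * a := by positivity
      rw [ht, h2]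
      constructor <;> linarith
    rw [Finset.sum_congr rfl fun i hi => Set.indicator_of_mem (hmem i hi) _,
      ← ENNReal.ofReal_sum_of_nonneg fun i _ => by positivity, periodicWeight, expSum,
      Finset.mul_sum, Finset.sum_mul, ← hs]
    congr 1
    refine Finset.sum_congr rfl fun i _ => ?_
    rw [he, mul_assoc _ (Real.exp _) (Real.exp _), ← Real.exp_add, mul_assoc (n * a)]
    congr 3
    rw [ht]
    ring
  · intro k hk
    refine Set.indicator_of_notMem (fun hmem => hk ?_) _
    obtain ⟨h1, h2⟩ := hmem
    have h3 : k ≤ j := by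
      have : (k : ℝ) < j + 1 := lt_of_mul_lt_mul_left (by linarith) ha.le
      exact Int.lt_add_one_iff.1 (by exact_mod_cast this)
    have h4 : j < k + n := by
      have : (j : ℝ) < k + n := lt_of_mul_lt_mul_left (by linarith) ha.le
      exact_mod_cast this
    rw [Finset.mem_map]
    refine ⟨(j - k).toNat, Finset.mem_range.2 (by omega), ?_⟩
    change j - ((j - k).toNat : ℤ) = k
    omega

/-- The frame sum of the one-sided exponential is a weighted `L²` norm. -/
lemma frameSum_dampedDiff {γ a : ℝ} (hγ : 0 < γ) (ha : 0 < a) {n : ℕ} (hn : 1 ≤ n) {G : ℝ → ℂ}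
    (hG : MemLp G 2 volume) :
    frameSum (oneSidedExp γ) (rectLattice a (1 / (n * a)))
        (dampedDiff (Real.exp (-γ * (n * a))) (n * a) G) =
      ∫⁻ t, ENNReal.ofReal (periodicWeight γ ha n t) * ‖G t‖ₑ ^ 2 := by
  have hn0 : (0 : ℝ) < n := by exact_mod_cast hn
  have hT : 0 < n * a := by positivity
  have hrow : ∀ k : ℤ, ∑' l : ℤ, ‖innerL2 (dampedDiff (Real.exp (-γ * (n * a))) (n * a) G)
      (timeFreqShift (a * k, 1 / (n * a) * l) (oneSidedExp γ))‖ₑ ^ 2 =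
      ∫⁻ t, (Set.Ioc (a * k) (a * k + n * a)).indicator
        (fun t : ℝ => ENNReal.ofReal (n * a * (2 * γ * Real.exp (-(2 * γ) * (t - a * k))))) t *
          ‖G t‖ₑ ^ 2 := by
    intro k
    have hH : MemLp (fun t => G t * (Real.sqrt (2 * γ) * Real.exp (-γ * (t - a * k)) : ℝ)) 2
        (volume.restrict (Set.Ioc (a * k) (a * k + n * a))) := by
      refine MemLp.of_le_mul (c := Real.sqrt (2 * γ)) (hG.restrict _)
        (hG.1.restrict.mul (by fun_prop)) ?_
      refine (ae_restrict_iff' measurableSet_Ioc).2 (Filter.Eventually.of_forall fun t ht => ?_)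
      rw [norm_mul, mul_comm, Complex.norm_real, Real.norm_of_nonneg (by positivity)]
      gcongr
      refine mul_le_of_le_one_right (Real.sqrt_nonneg _) (Real.exp_le_one_iff.2 ?_)
      nlinarith [ht.1]
    simp_rw [innerL2_dampedDiff hγ hT hG]
    rw [tsum_enorm_sq_integral_mul_exp hT _ hH, ← lintegral_const_mul' _ _ ENNReal.ofReal_ne_top,
      ← lintegral_indicator measurableSet_Ioc]
    refine lintegral_congr fun t => ?_
    by_cases ht : t ∈ Set.Ioc (a * k) (a * k + n * a)
    · simp only [Set.indicator_of_mem ht]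
      rw [enorm_mul, mul_pow, ← ofReal_norm ((_ : ℝ) : ℂ), Complex.norm_real,
        Real.norm_of_nonneg (by positivity), ← ENNReal.ofReal_pow (by positivity), mul_pow,
        Real.sq_sqrt (by positivity), ← Real.exp_nat_mul, mul_comm (‖G t‖ₑ ^ 2), ← mul_assoc,
        ← ENNReal.ofReal_mul hT.le]
      congr 5
      push_cast
      ring
    · simp only [Set.indicator_of_notMem ht, zero_mul]
  rw [frameSum_rectLattice _ _ ha.ne' (by positivity)]
  simp_rw [hrow]
  rw [← lintegral_tsum]
  · refine lintegral_congr fun t => ?_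
    rw [ENNReal.tsum_mul_right, tsum_indicator_exp hγ ha]
  · intro k
    refine AEMeasurable.mul ?_ (hG.1.enorm.pow_const _)
    exact (Measurable.indicator (by fun_prop) measurableSet_Ioc).aemeasurable

/-! ### Norm estimates and bump trains -/

lemma lintegral_enorm_sq_eq_ofReal {G : ℝ → ℂ} (hG : MemLp G 2 volume) :
    ∫⁻ t, ‖G t‖ₑ ^ 2 = ENNReal.ofReal (lpNorm G 2 volume ^ 2) := by
  rw [ENNReal.ofReal_pow lpNorm_nonneg, ofReal_lpNorm hG]
  have := eLpNorm_nnreal_pow_eq_lintegral (f := G) (μ := volume) (p := 2) two_ne_zero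
  norm_num at this
  exact this.symm

lemma lpNorm_translate {G : ℝ → ℂ} (hG : MemLp G 2 volume) (T : ℝ) :
    lpNorm (fun t => G (t + T)) 2 volume = lpNorm G 2 volume := by
  rw [← toReal_eLpNorm hG.1, ← toReal_eLpNorm (memLp_translate hG T).1, eLpNorm_translate hG]

lemma lpNorm_ofReal_mul (c : ℝ) (G : ℝ → ℂ) :
    lpNorm (fun t => (c : ℂ) * G t) 2 volume = |c| * lpNorm G 2 volume := by
  have := lpNorm_const_smul (p := 2) (c : ℂ) G volume
  simpa [Pi.smul_def] using this

lemma lpNorm_dampedDiff_le {ρ : ℝ} (h0 : 0 ≤ ρ) (T : ℝ) {G : ℝ → ℂ} (hG : MemLp G 2 volume) :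
    lpNorm (dampedDiff ρ T G) 2 volume ≤ (1 + ρ) * lpNorm G 2 volume := by
  have h := lpNorm_sub_le (g := fun t => (ρ : ℂ) * G (t + T)) hG one_le_two
  rw [lpNorm_ofReal_mul ρ (fun t => G (t + T)), lpNorm_translate hG, abs_of_nonneg h0] at h
  calc _ ≤ _ := h
    _ = _ := by ring

lemma le_lpNorm_dampedDiff {ρ : ℝ} (h0 : 0 ≤ ρ) (T : ℝ) {G : ℝ → ℂ} (hG : MemLp G 2 volume) :
    (1 - ρ) * lpNorm G 2 volume ≤ lpNorm (dampedDiff ρ T G) 2 volume := by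
  have h := lpNorm_add_le (g := fun t => (ρ : ℂ) * G (t + T)) (memLp_dampedDiff hG ρ T) one_le_two
  rw [lpNorm_ofReal_mul ρ (fun t => G (t + T)), lpNorm_translate hG, abs_of_nonneg h0] at h
  have e : (dampedDiff ρ T G + fun t => (ρ : ℂ) * G (t + T)) = G := by
    ext t
    simp [dampedDiff]
  rw [e] at h
  linarith

/-- A signed sum of translates of an indicator function. -/
def bumpTrain (s T : ℝ) (I : Set ℝ) (N : ℕ) (t : ℝ) : ℂ :=
  ∑ m ∈ Finset.range N, (s : ℂ) ^ m * I.indicator (fun _ => (1 : ℂ)) (t - m * T)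

lemma memLp_indicator_one {I : Set ℝ} (hI : MeasurableSet I) (hvol : volume I ≠ ∞) :
    MemLp (I.indicator fun _ => (1 : ℂ)) 2 volume :=
  memLp_indicator_const 2 hI 1 (Or.inr hvol)

lemma memLp_bumpTrain (s T : ℝ) {I : Set ℝ} (hI : MeasurableSet I) (hvol : volume I ≠ ∞) (N : ℕ) :
    MemLp (bumpTrain s T I N) 2 volume := by
  refine memLp_finsetSum _ fun m _ => MemLp.const_mul ?_ _
  simpa only [sub_eq_add_neg] using memLp_translate (memLp_indicator_one hI hvol) (-(m * T))

lemma exists_of_bumpTrain_ne_zero {s T : ℝ} {I : Set ℝ} {N : ℕ} {t : ℝ}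
    (h : bumpTrain s T I N t ≠ 0) : ∃ m : ℕ, t - m * T ∈ I := by
  by_contra! hc
  exact h (Finset.sum_eq_zero fun m _ => by rw [Set.indicator_of_notMem (hc m), mul_zero])

/-- Since `s² = 1`, the sum telescopes and only the two end bumps survive. -/
lemma bumpTrain_sub_translate {s : ℝ} (hs : s ^ 2 = 1) (T : ℝ) (I : Set ℝ) (N : ℕ) (t : ℝ) :
    bumpTrain s T I N t - s * bumpTrain s T I N (t + T) =
      (s : ℂ) ^ (N + 1) * I.indicator (fun _ => (1 : ℂ)) (t + (T - N * T)) -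
        s * I.indicator (fun _ => (1 : ℂ)) (t + T) := by
  have hs' : (s : ℂ) ^ 2 = 1 := by exact_mod_cast hs
  have h := Finset.sum_range_sub
    (fun m : ℕ => (s : ℂ) ^ (m + 1) * I.indicator (fun _ => (1 : ℂ)) (t + (T - m * T))) N
  simp only [Nat.cast_zero, zero_mul, sub_zero, zero_add, pow_one] at h
  rw [← h, bumpTrain, bumpTrain, Finset.mul_sum, ← Finset.sum_sub_distrib]
  refine Finset.sum_congr rfl fun m _ => ?_
  have e1 : t + (T - ((m + 1 : ℕ) : ℝ) * T) = t - m * T := by push_cast; ring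
  have e2 : t + (T - m * T) = t + T - m * T := by ring
  rw [e1, e2, show (s : ℂ) ^ (m + 1 + 1) = s ^ m * s ^ 2 by ring, hs']
  ring

/-- The bound does not depend on `N`, whereas the norm of the train grows like `√N`: long trains are
approximate eigenvectors of translation by `T` with eigenvalue `s = ±1`. -/
lemma lpNorm_bumpTrain_sub_translate_le {s : ℝ} (hs : s ^ 2 = 1) (T : ℝ) {I : Set ℝ}
    (hI : MeasurableSet I) (hvol : volume I ≠ ∞) (N : ℕ) :
    lpNorm (fun t => bumpTrain s T I N t - s * bumpTrain s T I N (t + T)) 2 volume ≤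
      2 * lpNorm (I.indicator fun _ => (1 : ℂ)) 2 volume := by
  have hχ := memLp_indicator_one hI hvol
  have habs : |s| = 1 := by
    rw [← sq_eq_sq₀ (abs_nonneg s) zero_le_one, sq_abs, hs, one_pow]
  have h := lpNorm_sub_le (g := fun t => (s : ℂ) * I.indicator (fun _ => (1 : ℂ)) (t + T))
    ((memLp_translate hχ (T - N * T)).const_mul (((s ^ (N + 1) : ℝ)) : ℂ)) one_le_two
  rw [lpNorm_ofReal_mul _ (fun t => I.indicator (fun _ => (1 : ℂ)) (t + (T - N * T))),
    lpNorm_ofReal_mul _ (fun t => I.indicator (fun _ => (1 : ℂ)) (t + T)), lpNorm_translate hχ,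
    lpNorm_translate hχ, abs_pow, habs, one_pow, one_mul, ← two_mul] at h
  convert h using 2
  ext t
  rw [bumpTrain_sub_translate hs]
  simp

/-- The bumps are disjoint because `I` fits into one period, so at most one term is nonzero at each
point. -/
lemma enorm_sq_bumpTrain {s T : ℝ} (hs : s ^ 2 = 1) (hT : 0 < T) {I : Set ℝ}
    (hIT : I ⊆ Set.Ioc 0 T) (N : ℕ) (t : ℝ) :
    ‖bumpTrain s T I N t‖ₑ ^ 2 =
      ∑ m ∈ Finset.range N, I.indicator (fun _ => (1 : ℝ≥0∞)) (t - m * T) := by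
  have habs : |s| = 1 := by
    rw [← sq_eq_sq₀ (abs_nonneg s) zero_le_one, sq_abs, hs, one_pow]
  by_cases h : ∃ m ∈ Finset.range N, t - m * T ∈ I
  · obtain ⟨m, hm, hmI⟩ := h
    have huniq : ∀ m' : ℕ, m' ≠ m → t - m' * T ∉ I := by
      intro m' hne hI'
      have hdiv : ∀ i : ℕ, t - i * T ∈ I → toIocDiv hT 0 t = i := fun i hi => by
        rw [toIocDiv_eq_iff]
        simpa using hIT hi
      have := (hdiv m hmI).symm.trans (hdiv m' hI')
      exact hne (by exact_mod_cast this.symm)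
    rw [bumpTrain, Finset.sum_eq_single_of_mem m hm, Finset.sum_eq_single_of_mem m hm,
      Set.indicator_of_mem hmI, Set.indicator_of_mem hmI, mul_one, ← ofReal_norm, norm_pow,
      Complex.norm_real, Real.norm_eq_abs, habs]
    · simp
    · intro m' _ hne
      exact Set.indicator_of_notMem (huniq m' hne) _
    · intro m' _ hne
      rw [Set.indicator_of_notMem (huniq m' hne), mul_zero]
  · push Not at h
    rw [bumpTrain, Finset.sum_eq_zero, Finset.sum_eq_zero]
    · simp
    · exact fun m hm => Set.indicator_of_notMem (h m hm) _
    · exact fun m hm => by rw [Set.indicator_of_notMem (h m hm), mul_zero]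

/-- Taking a square number of bumps keeps square roots out of the norm. -/
lemma lpNorm_bumpTrain {s T : ℝ} (hs : s ^ 2 = 1) (hT : 0 < T) {I : Set ℝ}
    (hI : MeasurableSet I) (hIT : I ⊆ Set.Ioc 0 T) (M : ℕ) :
    lpNorm (bumpTrain s T I (M ^ 2)) 2 volume =
      M * lpNorm (I.indicator fun _ => (1 : ℂ)) 2 volume := by
  have hvol : volume I ≠ ∞ := ((measure_mono hIT).trans_lt measure_Ioc_lt_top).ne
  have h1 := lintegral_enorm_sq_eq_ofReal (memLp_bumpTrain s T hI hvol (M ^ 2))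
  have h2 := lintegral_enorm_sq_eq_ofReal (memLp_indicator_one hI hvol)
  have h3 : ∫⁻ t, ‖I.indicator (fun _ => (1 : ℂ)) t‖ₑ ^ 2 = volume I := by
    rw [← lintegral_indicator_one hI]
    refine lintegral_congr fun t => ?_
    by_cases ht : t ∈ I <;> simp [ht]
  have h4 : ∫⁻ t, ‖bumpTrain s T I (M ^ 2) t‖ₑ ^ 2 = (M ^ 2 : ℕ) * volume I := by
    simp_rw [enorm_sq_bumpTrain hs hT hIT]
    have hmeas : Measurable (I.indicator fun _ => (1 : ℝ≥0∞)) := measurable_const.indicator hI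
    rw [lintegral_finsetSum (f := fun (m : ℕ) t => I.indicator (fun _ => (1 : ℝ≥0∞)) (t - m * T)) _
      fun m _ => hmeas.comp (measurable_sub_const ((m : ℝ) * T))]
    simp_rw [lintegral_sub_right_eq_self (I.indicator fun _ => (1 : ℝ≥0∞))]
    rw [Finset.sum_const, Finset.card_range, nsmul_eq_mul]
    congr 1
    exact lintegral_indicator_one hI
  rw [h4, ← h3, h2, ← ENNReal.ofReal_natCast, ← ENNReal.ofReal_mul (by positivity),
    ENNReal.ofReal_eq_ofReal_iff (by positivity) (by positivity)] at h1
  rw [← sq_eq_sq₀ lpNorm_nonneg (mul_nonneg (by positivity) lpNorm_nonneg), ← h1]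
  push_cast
  ring

/-! ### Sharp frame bounds -/

/-- The factor `2γ n a ∑_{i < n} e^{-2γ i a}`, the supremum of `periodicWeight`. -/
def weightSup (γ a : ℝ) (n : ℕ) : ℝ :=
  n * a * (2 * γ) * expSum γ a n

lemma expSum_pos (γ a : ℝ) {n : ℕ} (hn : 1 ≤ n) : 0 < expSum γ a n :=
  Finset.sum_pos (fun _ _ => Real.exp_pos _) ⟨0, Finset.mem_range.2 hn⟩

lemma weightSup_pos {γ a : ℝ} (hγ : 0 < γ) (ha : 0 < a) {n : ℕ} (hn : 1 ≤ n) :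
    0 < weightSup γ a n := by
  have := expSum_pos γ a hn
  have : (0 : ℝ) < n := by exact_mod_cast hn
  rw [weightSup]
  positivity

lemma periodicWeight_mem_Icc {γ a : ℝ} (hγ : 0 < γ) (ha : 0 < a) {n : ℕ} (hn : 1 ≤ n) {p q t : ℝ}
    (ht : toIocMod ha 0 t ∈ Set.Icc p q) :
    periodicWeight γ ha n t ∈ Set.Icc (weightSup γ a n * Real.exp (-(2 * γ) * q))
      (weightSup γ a n * Real.exp (-(2 * γ) * p)) := by
  have := weightSup_pos hγ ha hn
  rw [periodicWeight, ← weightSup]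
  constructor <;> refine mul_le_mul_of_nonneg_left (Real.exp_le_exp.2 ?_) this.le
  · nlinarith [ht.2]
  · nlinarith [ht.1]

/-- Bounds on the weighted norm of a function supported where the weight is controlled. -/
lemma lintegral_periodicWeight_mem_Icc {γ a : ℝ} (hγ : 0 < γ) (ha : 0 < a) {n : ℕ} (hn : 1 ≤ n)
    {G : ℝ → ℂ} (hG : MemLp G 2 volume) {p q : ℝ}
    (hpq : ∀ t, G t ≠ 0 → toIocMod ha 0 t ∈ Set.Icc p q) :
    ∫⁻ t, ENNReal.ofReal (periodicWeight γ ha n t) * ‖G t‖ₑ ^ 2 ∈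
      Set.Icc (ENNReal.ofReal (weightSup γ a n * Real.exp (-(2 * γ) * q) * lpNorm G 2 volume ^ 2))
        (ENNReal.ofReal (weightSup γ a n * Real.exp (-(2 * γ) * p) * lpNorm G 2 volume ^ 2)) := by
  have := weightSup_pos hγ ha hn
  rw [ENNReal.ofReal_mul (q := lpNorm G 2 volume ^ 2) (by positivity),
    ENNReal.ofReal_mul (q := lpNorm G 2 volume ^ 2) (by positivity),
    ← lintegral_enorm_sq_eq_ofReal hG, ← lintegral_const_mul' _ _ ENNReal.ofReal_ne_top,
    ← lintegral_const_mul' _ _ ENNReal.ofReal_ne_top]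
  constructor <;> refine lintegral_mono fun t => ?_ <;> by_cases ht : G t = 0
  · simp [ht]
  · have := periodicWeight_mem_Icc hγ ha hn (hpq t ht)
    dsimp only
    gcongr
    exact this.1
  · simp [ht]
  · have := periodicWeight_mem_Icc hγ ha hn (hpq t ht)
    dsimp only
    gcongr
    exact this.2

/-- The sharp lower frame bound of the one-sided exponential over `aℤ × (na)⁻¹ℤ`. -/
def lowerConst (γ a : ℝ) (n : ℕ) : ℝ :=
  weightSup γ a n * Real.exp (-(2 * γ) * a) / (1 + Real.exp (-γ * (n * a))) ^ 2

/-- The sharp upper frame bound of the one-sided exponential over `aℤ × (na)⁻¹ℤ`. -/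
def upperConst (γ a : ℝ) (n : ℕ) : ℝ :=
  weightSup γ a n / (1 - Real.exp (-γ * (n * a))) ^ 2

lemma exp_neg_lt_one {γ a : ℝ} (hγ : 0 < γ) (ha : 0 < a) {n : ℕ} (hn : 1 ≤ n) :
    Real.exp (-γ * (n * a)) < 1 := by
  have : (0 : ℝ) < n := by exact_mod_cast hn
  rw [Real.exp_lt_one_iff, neg_mul]
  exact neg_neg_of_pos (by positivity)

lemma frameSum_bounds {γ a : ℝ} (hγ : 0 < γ) (ha : 0 < a) {n : ℕ} (hn : 1 ≤ n) :
    IsLowerBound (oneSidedExp γ) (rectLattice a (1 / (n * a))) (ENNReal.ofReal (lowerConst γ a n)) ∧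
    IsUpperBound (oneSidedExp γ) (rectLattice a (1 / (n * a)))
      (ENNReal.ofReal (upperConst γ a n)) := by
  have hw := weightSup_pos hγ ha hn
  have hρ1 := exp_neg_lt_one hγ ha hn
  have hρ0 := Real.exp_pos (-γ * (n * a))
  have key : ∀ f : ℝ → ℂ, MemLp f 2 volume → ∃ y : ℝ, 0 ≤ y ∧
      lpNorm f 2 volume ≤ (1 + Real.exp (-γ * (n * a))) * y ∧
      (1 - Real.exp (-γ * (n * a))) * y ≤ lpNorm f 2 volume ∧
      frameSum (oneSidedExp γ) (rectLattice a (1 / (n * a))) f ∈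
        Set.Icc (ENNReal.ofReal (weightSup γ a n * Real.exp (-(2 * γ) * a) * y ^ 2))
          (ENNReal.ofReal (weightSup γ a n * y ^ 2)) := by
    intro f hf
    obtain ⟨G, hG, hfG⟩ := exists_dampedDiff_ae_eq hρ0.le hρ1 (n * a) hf
    have hnorm : lpNorm f 2 volume =
        lpNorm (dampedDiff (Real.exp (-γ * (n * a))) (n * a) G) 2 volume := by
      rw [← toReal_eLpNorm hf.1, ← toReal_eLpNorm (memLp_dampedDiff hG _ _).1, eLpNorm_congr_ae hfG]
    refine ⟨lpNorm G 2 volume, lpNorm_nonneg, ?_, ?_, ?_⟩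
    · exact hnorm ▸ lpNorm_dampedDiff_le hρ0.le _ hG
    · exact hnorm ▸ le_lpNorm_dampedDiff hρ0.le _ hG
    · rw [frameSum_congr hfG, frameSum_dampedDiff hγ ha hn hG]
      -- With the whole period `[0, a]` the support condition always holds.
      have := lintegral_periodicWeight_mem_Icc hγ ha hn hG (p := 0) (q := a)
        (fun t _ => ⟨(left_lt_toIocMod ha 0 t).le, by simpa using toIocMod_le_right ha 0 t⟩)
      simpa using this
  constructor
  · intro f hf
    obtain ⟨y, hy, h1, -, h2, -⟩ := key f hf
    refine le_trans ?_ h2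
    rw [← ofReal_lpNorm hf, ← ENNReal.ofReal_pow lpNorm_nonneg,
      ← ENNReal.ofReal_mul (by rw [lowerConst]; positivity)]
    refine ENNReal.ofReal_le_ofReal ?_
    rw [lowerConst, div_mul_eq_mul_div, div_le_iff₀ (by positivity), mul_assoc _ (y ^ 2), ← mul_pow,
      mul_comm y]
    gcongr
    exact lpNorm_nonneg
  · intro f hf
    obtain ⟨y, hy, -, h1, -, h2⟩ := key f hf
    refine h2.trans ?_
    have h3 : 0 < 1 - Real.exp (-γ * (n * a)) := by linarith
    rw [← ofReal_lpNorm hf, ← ENNReal.ofReal_pow lpNorm_nonneg,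
      ← ENNReal.ofReal_mul (by rw [upperConst]; positivity)]
    refine ENNReal.ofReal_le_ofReal ?_
    rw [upperConst, div_mul_eq_mul_div, le_div_iff₀ (by positivity), mul_assoc _ (y ^ 2), ← mul_pow,
      mul_comm y]
    gcongr

/-- Functions whose frame sum is close to extremal. -/
lemma exists_frameSum_near {γ a : ℝ} (hγ : 0 < γ) (ha : 0 < a) {n : ℕ} (hn : 1 ≤ n) {s : ℝ}
    (hs : s ^ 2 = 1) {p q : ℝ} (hp : 0 ≤ p) (hpq : p < q) (hq : q ≤ a) {M : ℕ} (hM : 0 < M) :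
    ∃ f : ℝ → ℂ, MemLp f 2 volume ∧ ∃ y : ℝ, 0 < y ∧
      |lpNorm f 2 volume - (1 - s * Real.exp (-γ * (n * a))) * y| ≤ 2 / M * y ∧
      frameSum (oneSidedExp γ) (rectLattice a (1 / (n * a))) f ∈
        Set.Icc (ENNReal.ofReal (weightSup γ a n * Real.exp (-(2 * γ) * q) * y ^ 2))
          (ENNReal.ofReal (weightSup γ a n * Real.exp (-(2 * γ) * p) * y ^ 2)) := by
  set ρ := Real.exp (-γ * (n * a)) with hρ
  have hρ1 : ρ < 1 := exp_neg_lt_one hγ ha hn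
  have hρ0 : 0 < ρ := Real.exp_pos _
  have hn1 : (1 : ℝ) ≤ n := by exact_mod_cast hn
  have hT : 0 < n * a := by positivity
  have habs : |s| = 1 := by
    rw [← sq_eq_sq₀ (abs_nonneg s) zero_le_one, sq_abs, hs, one_pow]
  set I := Set.Ioc p q with hI
  have hIa : I ⊆ Set.Ioc 0 a := Set.Ioc_subset_Ioc hp hq
  have hIT : I ⊆ Set.Ioc 0 (n * a) :=
    hIa.trans (Set.Ioc_subset_Ioc_right (le_mul_of_one_le_left ha.le hn1))
  have hvol : volume I ≠ ∞ := measure_Ioc_lt_top.ne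
  set χ : ℝ → ℂ := I.indicator fun _ => (1 : ℂ)
  have hχ : MemLp χ 2 volume := memLp_indicator_one measurableSet_Ioc hvol
  have hχpos : 0 < lpNorm χ 2 volume := by
    refine lpNorm_nonneg.lt_of_ne' fun h0 => ?_
    rw [lpNorm_eq_zero hχ two_ne_zero] at h0
    have : volume I = 0 := by
      refine measure_mono_null (fun t ht => ?_) (ae_iff.1 h0)
      simp [χ, ht]
    rw [hI, Real.volume_Ioc, ENNReal.ofReal_eq_zero] at this
    linarith
  set G := bumpTrain s (n * a) I (M ^ 2) with hGdef
  have hG : MemLp G 2 volume := memLp_bumpTrain s _ measurableSet_Ioc hvol _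
  have hGn : lpNorm G 2 volume = M * lpNorm χ 2 volume :=
    lpNorm_bumpTrain hs hT measurableSet_Ioc hIT M
  have hM' : (0 : ℝ) < M := by exact_mod_cast hM
  refine ⟨dampedDiff ρ (n * a) G, memLp_dampedDiff hG _ _, lpNorm G 2 volume, ?_, ?_, ?_⟩
  · rw [hGn]
    positivity
  · set D : ℝ → ℂ := fun t => ((s * ρ : ℝ) : ℂ) * (G t - s * G (t + n * a)) with hD
    set E : ℝ → ℂ := fun t => ((1 - s * ρ : ℝ) : ℂ) * G t with hE
    have hEL : MemLp E 2 volume := hG.const_mul _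
    have hDL : MemLp D 2 volume := (hG.sub ((memLp_translate hG _).const_mul _)).const_mul _
    -- `G - ρ G(· + T) = (1 - sρ) G + sρ (G - s G(· + T))` by `s² = 1`: the eigenvector part, plus
    -- an error of relative size at most `2 / M`.
    have hsum : dampedDiff ρ (n * a) G = E + D := by
      have hs' : (s : ℂ) ^ 2 = 1 := by exact_mod_cast hs
      ext t
      simp only [dampedDiff, hE, hD, Pi.add_apply]
      push_cast
      linear_combination ((ρ : ℂ) * G (t + n * a)) * hs'
    have hDn : lpNorm D 2 volume ≤ 2 / M * lpNorm G 2 volume := by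
      rw [hD, lpNorm_ofReal_mul _ (fun t => G t - s * G (t + n * a)), abs_mul, habs, one_mul,
        abs_of_pos hρ0, hGn]
      have := lpNorm_bumpTrain_sub_translate_le hs (n * a) (measurableSet_Ioc : MeasurableSet I)
        hvol (M ^ 2)
      calc ρ * _ ≤ 1 * (2 * lpNorm χ 2 volume) := mul_le_mul hρ1.le this lpNorm_nonneg zero_le_one
        _ = _ := by field_simp
    have hEn : lpNorm E 2 volume = (1 - s * ρ) * lpNorm G 2 volume := by
      rw [hE, lpNorm_ofReal_mul, abs_of_nonneg]
      have : |s * ρ| < 1 := by rwa [abs_mul, habs, one_mul, abs_of_pos hρ0]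
      linarith [(abs_lt.1 this).2]
    rw [← hEn, hsum, abs_le]
    have h1 := lpNorm_add_le (g := D) hEL one_le_two
    have h2 := lpNorm_sub_le (g := D) (hEL.add hDL) one_le_two
    rw [add_sub_cancel_right] at h2
    constructor <;> linarith
  · rw [frameSum_dampedDiff hγ ha hn hG]
    refine lintegral_periodicWeight_mem_Icc hγ ha hn hG fun t ht => ?_
    obtain ⟨m, hm⟩ := exists_of_bumpTrain_ne_zero ht
    -- The bumps are `n a` apart, a multiple of the period of the weight, so every bump sees the
    -- same weight as `I`.
    have hmod : toIocMod ha 0 t = t - m * (n * a) := by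
      rw [toIocMod_eq_iff]
      refine ⟨by simpa using hIa hm, (m * n : ℕ), ?_⟩
      rw [natCast_zsmul, nsmul_eq_mul]
      push_cast
      ring
    rw [hmod]
    exact ⟨hm.1.le, hm.2⟩

lemma tendsto_one_div_natCast_add_two :
    Filter.Tendsto (fun m : ℕ => 1 / ((m + 2 : ℕ) : ℝ)) Filter.atTop (nhds 0) :=
  (Filter.tendsto_add_atTop_iff_nat 2).2 tendsto_one_div_atTop_nhds_zero_nat

/-- Tested on alternating trains (`s = -1`, largest `‖f‖`) concentrated at the right end of the
period, where the weight is smallest. -/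
lemma le_lowerConst_of_isLowerBound {γ a : ℝ} (hγ : 0 < γ) (ha : 0 < a) {n : ℕ} (hn : 1 ≤ n)
    {r : ℝ} (hr : 0 ≤ r)
    (h : IsLowerBound (oneSidedExp γ) (rectLattice a (1 / (n * a))) (ENNReal.ofReal r)) :
    r ≤ lowerConst γ a n := by
  have hw := weightSup_pos hγ ha hn
  rw [lowerConst, le_div_iff₀ (by positivity)]
  set ρ := Real.exp (-γ * (n * a)) with hρ
  have hρ0 : 0 < ρ := Real.exp_pos _
  have key : ∀ m : ℕ, r * (1 + ρ - 2 * (1 / ((m + 2 : ℕ) : ℝ))) ^ 2 ≤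
      weightSup γ a n * Real.exp (-(2 * γ) * (a - a * (1 / ((m + 2 : ℕ) : ℝ)))) := by
    intro m
    have hδ0 : 0 < 1 / ((m + 2 : ℕ) : ℝ) := by positivity
    -- The offset `2` keeps `1 + ρ - 2δ` nonnegative, as squaring requires.
    have hδ1 : 1 / ((m + 2 : ℕ) : ℝ) ≤ 1 / 2 := by
      apply one_div_le_one_div_of_le two_pos
      push_cast
      linarith [(Nat.cast_nonneg m : (0 : ℝ) ≤ m)]
    obtain ⟨f, hf, y, hy, h1, -, h2⟩ := exists_frameSum_near hγ ha hn (s := -1) (by norm_num)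
      (p := a - a * (1 / ((m + 2 : ℕ) : ℝ))) (q := a) (by nlinarith) (by nlinarith) le_rfl
      (M := m + 2) (by omega)
    have h3 := (h f hf).trans h2
    rw [← ofReal_lpNorm hf, ← ENNReal.ofReal_pow lpNorm_nonneg, ← ENNReal.ofReal_mul hr,
      ENNReal.ofReal_le_ofReal_iff (by positivity)] at h3
    rw [← hρ, div_eq_mul_one_div] at h1
    have h4 : (1 + ρ - 2 * (1 / ((m + 2 : ℕ) : ℝ))) * y ≤ lpNorm f 2 volume := by
      linarith [(abs_le.1 h1).1]
    have h5 : 0 ≤ 1 + ρ - 2 * (1 / ((m + 2 : ℕ) : ℝ)) := by linarith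
    refine le_of_mul_le_mul_right (le_trans ?_ h3) (pow_pos hy 2)
    rw [mul_assoc, ← mul_pow]
    gcongr
  have hlim := tendsto_one_div_natCast_add_two
  have hc1 : Continuous fun δ : ℝ => r * (1 + ρ - 2 * δ) ^ 2 := by fun_prop
  have hc2 : Continuous fun δ : ℝ => weightSup γ a n * Real.exp (-(2 * γ) * (a - a * δ)) := by
    fun_prop
  simpa using le_of_tendsto_of_tendsto' ((hc1.tendsto 0).comp hlim) ((hc2.tendsto 0).comp hlim) key

/-- Tested on trains of constant sign (`s = 1`, smallest `‖f‖`) concentrated at the left end of the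
period, where the weight is largest. -/
lemma upperConst_le_of_isUpperBound {γ a : ℝ} (hγ : 0 < γ) (ha : 0 < a) {n : ℕ} (hn : 1 ≤ n)
    {r : ℝ} (hr : 0 ≤ r)
    (h : IsUpperBound (oneSidedExp γ) (rectLattice a (1 / (n * a))) (ENNReal.ofReal r)) :
    upperConst γ a n ≤ r := by
  have hρ1 := exp_neg_lt_one hγ ha hn
  have hw := weightSup_pos hγ ha hn
  rw [upperConst, div_le_iff₀ (pow_pos (by linarith) 2)]
  set ρ := Real.exp (-γ * (n * a)) with hρ
  have key : ∀ m : ℕ, weightSup γ a n * Real.exp (-(2 * γ) * (a * (1 / ((m + 2 : ℕ) : ℝ)))) ≤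
      r * (1 - ρ + 2 * (1 / ((m + 2 : ℕ) : ℝ))) ^ 2 := by
    intro m
    have hδ0 : 0 < 1 / ((m + 2 : ℕ) : ℝ) := by positivity
    have hδ1 : 1 / ((m + 2 : ℕ) : ℝ) ≤ 1 := by
      rw [div_le_one (by positivity)]
      push_cast
      linarith [(Nat.cast_nonneg m : (0 : ℝ) ≤ m)]
    obtain ⟨f, hf, y, hy, h1, h2, -⟩ := exists_frameSum_near hγ ha hn (s := 1) (by norm_num)
      (p := 0) (q := a * (1 / ((m + 2 : ℕ) : ℝ))) le_rfl (by positivity) (by nlinarith)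
      (M := m + 2) (by omega)
    have h3 := h2.trans (h f hf)
    rw [← ofReal_lpNorm hf, ← ENNReal.ofReal_pow lpNorm_nonneg, ← ENNReal.ofReal_mul hr,
      ENNReal.ofReal_le_ofReal_iff (mul_nonneg hr (sq_nonneg _))] at h3
    rw [← hρ, div_eq_mul_one_div] at h1
    have h4 : lpNorm f 2 volume ≤ (1 - ρ + 2 * (1 / ((m + 2 : ℕ) : ℝ))) * y := by
      linarith [(abs_le.1 h1).2]
    refine le_of_mul_le_mul_right (h3.trans ?_) (pow_pos hy 2)
    rw [mul_assoc, ← mul_pow]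
    gcongr
    exact lpNorm_nonneg
  have hlim := tendsto_one_div_natCast_add_two
  have hc1 : Continuous fun δ : ℝ => r * (1 - ρ + 2 * δ) ^ 2 := by fun_prop
  have hc2 : Continuous fun δ : ℝ => weightSup γ a n * Real.exp (-(2 * γ) * (a * δ)) := by
    fun_prop
  simpa using le_of_tendsto_of_tendsto' ((hc2.tendsto 0).comp hlim) ((hc1.tendsto 0).comp hlim) key

theorem lowerFrameBound_oneSidedExp {γ a : ℝ} (hγ : 0 < γ) (ha : 0 < a) {n : ℕ} (hn : 1 ≤ n) :
    lowerFrameBound (oneSidedExp γ) (rectLattice a (1 / (n * a))) =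
      ENNReal.ofReal (lowerConst γ a n) := by
  refine le_antisymm (sSup_le fun A hA => ?_) (le_sSup (frameSum_bounds hγ ha hn).1)
  -- A lower bound `A` could a priori be `∞`; comparing finite `r < A` covers that case too.
  refine ENNReal.le_of_forall_nnreal_lt fun r hr => ?_
  rw [← ENNReal.ofReal_coe_nnreal]
  refine ENNReal.ofReal_le_ofReal (le_lowerConst_of_isLowerBound hγ ha hn r.2 fun f hf => ?_)
  refine le_trans ?_ (hA f hf)
  rw [ENNReal.ofReal_coe_nnreal]
  gcongr

theorem upperFrameBound_oneSidedExp {γ a : ℝ} (hγ : 0 < γ) (ha : 0 < a) {n : ℕ} (hn : 1 ≤ n) :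
    upperFrameBound (oneSidedExp γ) (rectLattice a (1 / (n * a))) =
      ENNReal.ofReal (upperConst γ a n) := by
  refine le_antisymm (sInf_le (frameSum_bounds hγ ha hn).2) (le_sInf fun B hB => ?_)
  rcases eq_or_ne B ∞ with rfl | hB'
  · exact le_top
  · rw [← ENNReal.ofReal_toReal hB'] at hB ⊢
    exact ENNReal.ofReal_le_ofReal
      (upperConst_le_of_isUpperBound hγ ha hn ENNReal.toReal_nonneg hB)

/-! ### Monotone logarithmic slopes -/

/-- The derivative of `F` at `u` is `ψ u / u` with `ψ` strictly decreasing, so that the zero of `ψ`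
is the strict global maximum of `F`. -/
lemma lt_of_hasDerivAt_div {F ψ : ℝ → ℝ} (hF : ∀ u, 0 < u → HasDerivAt F (ψ u / u) u)
    (hψ : StrictAntiOn ψ (Set.Ioi 0)) {c : ℝ} (hc : 0 < c) (hψc : ψ c = 0) {u : ℝ} (hu : 0 < u)
    (huc : u ≠ c) : F u < F c := by
  have hcont : ContinuousOn F (Set.Ioi 0) := fun u hu => (hF u hu).continuousAt.continuousWithinAt
  rcases huc.lt_or_gt with h | h
  · have hmono : StrictMonoOn F (Set.Icc u c) := by
      refine strictMonoOn_of_deriv_pos (convex_Icc u c)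
        (hcont.mono fun x hx => hu.trans_le hx.1) fun x hx => ?_
      rw [interior_Icc] at hx
      have hx0 : 0 < x := hu.trans hx.1
      rw [(hF x hx0).deriv]
      exact div_pos (hψc ▸ hψ hx0 hc hx.2) hx0
    exact hmono ⟨le_rfl, h.le⟩ ⟨h.le, le_rfl⟩ h
  · have hanti : StrictAntiOn F (Set.Icc c u) := by
      refine strictAntiOn_of_deriv_neg (convex_Icc c u)
        (hcont.mono fun x hx => hc.trans_le hx.1) fun x hx => ?_
      rw [interior_Icc] at hx
      have hx0 : 0 < x := hc.trans hx.1
      rw [(hF x hx0).deriv]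
      exact div_neg_of_neg_of_pos (hψc ▸ hψ hc hx0 hx.1) hx0
    exact hanti ⟨le_rfl, h.le⟩ ⟨h.le, le_rfl⟩ h

/-- Secant slopes from `0` of the strictly convex function `sinh` increase. -/
lemma strictAntiOn_div_sinh : StrictAntiOn (fun u : ℝ => u / Real.sinh u) (Set.Ioi 0) := by
  have hconv : StrictConvexOn ℝ (Set.Ici 0) Real.sinh := by
    refine StrictMonoOn.strictConvexOn_of_deriv (convex_Ici 0) Real.continuous_sinh.continuousOn ?_
    rw [Real.deriv_sinh, interior_Ici]
    exact Real.cosh_strictMonoOn.mono Set.Ioi_subset_Ici_self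
  intro u hu w hw huw
  have hu' : 0 < u := hu
  have hw' : 0 < w := hw
  have h := hconv.secant_strict_mono (a := 0) (x := u) (y := w) (by simp) hu'.le hw'.le hu'.ne'
    hw'.ne' huw
  simp only [Real.sinh_zero, sub_zero] at h
  have := one_div_lt_one_div_of_lt (div_pos (Real.sinh_pos_iff.2 hu') hu') h
  simpa using this

lemma exp_secant_lt {x y : ℝ} (hx : x ≠ 0) (hy : y ≠ 0) (hxy : x < y) :
    (Real.exp x - 1) / x < (Real.exp y - 1) / y := by
  have h := strictConvexOn_exp.secant_strict_mono (a := 0) (x := x) (y := y) (Set.mem_univ _)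
    (Set.mem_univ _) (Set.mem_univ _) hx hy hxy
  simpa using h

lemma exp_secant_pos {x : ℝ} (hx : x ≠ 0) : 0 < (Real.exp x - 1) / x := by
  rcases hx.lt_or_gt with h | h
  · exact div_pos_of_neg_of_neg (by linarith [Real.exp_lt_one_iff.2 h]) h
  · exact div_pos (by linarith [Real.one_lt_exp_iff.2 h]) h

lemma div_exp_sub_one_lt {x y : ℝ} (hx : x ≠ 0) (hy : y ≠ 0) (hxy : x < y) :
    y / (Real.exp y - 1) < x / (Real.exp x - 1) := by
  have := one_div_lt_one_div_of_lt (exp_secant_pos hx) (exp_secant_lt hx hy hxy)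
  simpa using this

/-- Shows that the last bracket of `lowerSlope` is `x / (e^x - 1)` at `x = -ku`, so one monotonicity
lemma, valid for both signs, serves both slopes. -/
lemma div_exp_neg_sub_one {x : ℝ} (hx : x ≠ 0) :
    -x / (Real.exp (-x) - 1) = x + x / (Real.exp x - 1) := by
  have h1 : Real.exp x - 1 ≠ 0 := fun h => hx (by simpa [sub_eq_zero] using h)
  have h2 : 1 - Real.exp x ≠ 0 := fun h => h1 (by linarith)
  rw [Real.exp_neg]
  have := Real.exp_pos x
  have h3 : (Real.exp x)⁻¹ - 1 = (1 - Real.exp x) / Real.exp x := by field_simp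
  rw [h3]
  field_simp
  ring

/-- `log tanh (u / 2)` -/
def logTanhHalf (u : ℝ) : ℝ :=
  Real.log (1 - Real.exp (-u)) - Real.log (1 + Real.exp (-u))

lemma one_sub_exp_neg_pos {u : ℝ} (hu : 0 < u) : 0 < 1 - Real.exp (-u) := by
  have := Real.exp_lt_one_iff.2 (neg_lt_zero.2 hu)
  linarith

lemma hasDerivAt_one_sub_exp_neg (k u : ℝ) :
    HasDerivAt (fun u => 1 - Real.exp (-(k * u))) (k * Real.exp (-(k * u))) u := by
  refine (((hasDerivAt_id u).const_mul k).neg.exp.const_sub 1).congr_deriv ?_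
  simp [mul_comm]

lemma hasDerivAt_logTanhHalf {u : ℝ} (hu : 0 < u) :
    HasDerivAt logTanhHalf (1 / Real.sinh u) u := by
  have h1 := one_sub_exp_neg_pos hu
  have h2 := Real.exp_pos (-u)
  have d := (hasDerivAt_id u).neg.exp
  have e1 := (d.const_sub 1).log h1.ne'
  have e2 := (d.const_add 1).log (by simp; positivity)
  refine (e1.sub e2).congr_deriv ?_
  have h3 : Real.sinh u = (1 - Real.exp (-u)) * (1 + Real.exp (-u)) / (2 * Real.exp (-u)) := by
    rw [Real.sinh_eq]
    field_simp
    have : Real.exp (-u) * Real.exp u = 1 := by rw [← Real.exp_add]; simp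
    linear_combination this
  rw [h3]
  simp
  field_simp
  ring

/-- `log (1 - e^{-k u})` has logarithmic derivative `k / (e^{k u} - 1)`. -/
lemma hasDerivAt_log_one_sub_exp_neg {k u : ℝ} (hk : 0 < k) (hu : 0 < u) :
    HasDerivAt (fun u => Real.log (1 - Real.exp (-(k * u)))) (k / (Real.exp (k * u) - 1)) u := by
  have hku : 0 < k * u := by positivity
  refine ((hasDerivAt_one_sub_exp_neg k u).log (one_sub_exp_neg_pos hku).ne').congr_deriv ?_
  have h1 := one_sub_exp_neg_pos hku
  have h2 : Real.exp (k * u) - 1 = (1 - Real.exp (-(k * u))) * Real.exp (k * u) := by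
    rw [sub_mul, ← Real.exp_add]; simp
  have h3 : Real.exp (-(k * u)) = (Real.exp (k * u))⁻¹ := Real.exp_neg _
  rw [h2, ← div_div, h3]
  field_simp

/-- The logarithm of half the lower frame bound, for `k = 2 / n`. -/
def logLower (k u : ℝ) : ℝ :=
  Real.log u + logTanhHalf u - Real.log (1 - Real.exp (-(k * u))) - k * u

/-- The logarithm of half the upper frame bound, for `k = 2 / n`. -/
def logUpper (k u : ℝ) : ℝ :=
  Real.log u - logTanhHalf u - Real.log (1 - Real.exp (-(k * u)))

/-- The logarithmic derivative `u (logLower k)' u`. -/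
def lowerSlope (k u : ℝ) : ℝ :=
  1 + u / Real.sinh u - (k * u + k * u / (Real.exp (k * u) - 1))

/-- The logarithmic derivative `u (logUpper k)' u`. -/
def upperSlope (k u : ℝ) : ℝ :=
  1 - u / Real.sinh u - k * u / (Real.exp (k * u) - 1)

lemma hasDerivAt_logLower {k u : ℝ} (hk : 0 < k) (hu : 0 < u) :
    HasDerivAt (logLower k) (lowerSlope k u / u) u := by
  have h := ((((Real.hasDerivAt_log hu.ne').add (hasDerivAt_logTanhHalf hu)).sub
    (hasDerivAt_log_one_sub_exp_neg hk hu)).sub ((hasDerivAt_id u).const_mul k))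
  refine h.congr_deriv ?_
  rw [lowerSlope]
  have : 0 < Real.sinh u := Real.sinh_pos_iff.2 hu
  field_simp
  ring

lemma hasDerivAt_logUpper {k u : ℝ} (hk : 0 < k) (hu : 0 < u) :
    HasDerivAt (logUpper k) (upperSlope k u / u) u := by
  have h := ((Real.hasDerivAt_log hu.ne').sub (hasDerivAt_logTanhHalf hu)).sub
    (hasDerivAt_log_one_sub_exp_neg hk hu)
  refine h.congr_deriv ?_
  rw [upperSlope]
  have : 0 < Real.sinh u := Real.sinh_pos_iff.2 hu
  field_simp

lemma strictAntiOn_lowerSlope {k : ℝ} (hk : 0 < k) : StrictAntiOn (lowerSlope k) (Set.Ioi 0) := by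
  intro u hu w hw huw
  have hu' : 0 < k * u := mul_pos hk hu
  have hw' : 0 < k * w := mul_pos hk hw
  have h1 := strictAntiOn_div_sinh hu hw huw
  have h2 := div_exp_sub_one_lt (neg_ne_zero.2 hw'.ne') (neg_ne_zero.2 hu'.ne')
    (neg_lt_neg (mul_lt_mul_of_pos_left huw hk))
  rw [div_exp_neg_sub_one hu'.ne', div_exp_neg_sub_one hw'.ne'] at h2
  simp only [lowerSlope] at h1 ⊢
  linarith

lemma strictMonoOn_upperSlope {k : ℝ} (hk : 0 < k) : StrictMonoOn (upperSlope k) (Set.Ioi 0) := by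
  intro u hu w hw huw
  have h1 := strictAntiOn_div_sinh hu hw huw
  have h2 := div_exp_sub_one_lt (mul_pos hk hu).ne' (mul_pos hk hw).ne'
    (mul_lt_mul_of_pos_left huw hk)
  simp only [upperSlope] at h1 ⊢
  linarith

lemma continuousOn_div_sinh : ContinuousOn (fun u : ℝ => u / Real.sinh u) (Set.Ioi 0) :=
  continuousOn_id.div Real.continuous_sinh.continuousOn
    fun _ hu => (Real.sinh_pos_iff.2 hu).ne'

lemma continuousOn_div_exp_sub_one {k : ℝ} (hk : 0 < k) :
    ContinuousOn (fun u : ℝ => k * u / (Real.exp (k * u) - 1)) (Set.Ioi 0) :=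
  ContinuousOn.div (by fun_prop) (by fun_prop) fun u hu =>
    (sub_pos.2 (Real.one_lt_exp_iff.2 (mul_pos hk hu))).ne'

lemma continuousOn_lowerSlope {k : ℝ} (hk : 0 < k) : ContinuousOn (lowerSlope k) (Set.Ioi 0) :=
  (continuousOn_const.add continuousOn_div_sinh).sub
    (ContinuousOn.add (by fun_prop) (continuousOn_div_exp_sub_one hk))

lemma continuousOn_upperSlope {k : ℝ} (hk : 0 < k) : ContinuousOn (upperSlope k) (Set.Ioi 0) :=
  (continuousOn_const.sub continuousOn_div_sinh).sub (continuousOn_div_exp_sub_one hk)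

/-- Equivalent to `tanh (x / 2) < x / 2`. -/
lemma one_sub_half_lt_div_exp_sub_one {x : ℝ} (hx : 0 < x) :
    1 - x / 2 < x / (Real.exp x - 1) := by
  have h0 : 0 < Real.exp x - 1 := sub_pos.2 (Real.one_lt_exp_iff.2 hx)
  rw [lt_div_iff₀ h0]
  have hsinh : x / 2 < Real.sinh (x / 2) := Real.self_lt_sinh_iff.2 (by linarith)
  -- Clearing denominators leaves `(2 - x) e^x < x + 2`. The difference of the two sides vanishes at
  -- `0` and increases, because `1 - y < e^{-y}`.
  have hd : ∀ y : ℝ, HasDerivAt (fun y => y + 2 - (2 - y) * Real.exp y)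
      (1 - (1 - y) * Real.exp y) y := by
    intro y
    have := ((hasDerivAt_id y).add_const 2).sub
      (((hasDerivAt_id y).const_sub 2).mul (Real.hasDerivAt_exp y))
    refine this.congr_deriv ?_
    simp
    ring
  have hmono : StrictMonoOn (fun y => y + 2 - (2 - y) * Real.exp y) (Set.Ici 0) := by
    refine strictMonoOn_of_deriv_pos (convex_Ici 0) (by fun_prop) fun y hy => ?_
    rw [interior_Ici] at hy
    rw [(hd y).deriv]
    have h1 : 1 - y < Real.exp (-y) := by
      have := Real.add_one_lt_exp (neg_ne_zero.2 (ne_of_gt hy))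
      linarith
    have h2 : (1 - y) * Real.exp y < Real.exp (-y) * Real.exp y :=
      mul_lt_mul_of_pos_right h1 (Real.exp_pos y)
    rw [← Real.exp_add, neg_add_cancel, Real.exp_zero] at h2
    linarith
  have := hmono (Set.mem_Ici.2 le_rfl) (Set.mem_Ici.2 hx.le) hx
  simp at this
  linarith

/-! ### Locating the extremal points relative to `arsinh n` -/

variable {γ a : ℝ} {n : ℕ}

lemma arsinh_natCast_pos (hn : 1 ≤ n) : 0 < Real.arsinh n :=
  Real.arsinh_pos_iff.2 (by exact_mod_cast hn)

/-- At `u = arsinh n` one has `u / sinh u = u / n = x / 2` with `x = ku`, so this slope and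
`upperSlope` both equal `1 - x/2 - x/(e^x - 1)`. -/
lemma lowerSlope_arsinh_neg (hn : 1 ≤ n) : lowerSlope (2 / n) (Real.arsinh n) < 0 := by
  have hu := arsinh_natCast_pos hn
  have hn0 : (0 : ℝ) < n := by exact_mod_cast hn
  have h := one_sub_half_lt_div_exp_sub_one (x := 2 / n * Real.arsinh n) (by positivity)
  rw [lowerSlope, Real.sinh_arsinh]
  have e : 2 / n * Real.arsinh n / 2 = Real.arsinh n / n := by ring
  have e' : 2 / n * Real.arsinh n = 2 * (Real.arsinh n / n) := by ring
  linarith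

lemma upperSlope_arsinh_neg (hn : 1 ≤ n) : upperSlope (2 / n) (Real.arsinh n) < 0 := by
  have hu := arsinh_natCast_pos hn
  have hn0 : (0 : ℝ) < n := by exact_mod_cast hn
  have h := one_sub_half_lt_div_exp_sub_one (x := 2 / n * Real.arsinh n) (by positivity)
  rw [upperSlope, Real.sinh_arsinh]
  have e : 2 / n * Real.arsinh n / 2 = Real.arsinh n / n := by ring
  linarith

lemma div_exp_sub_one_le_one {x : ℝ} (hx : 0 < x) : x / (Real.exp x - 1) ≤ 1 := by
  have := Real.add_one_lt_exp hx.ne'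
  rw [div_le_one (by linarith)]
  linarith

lemma exists_lowerSlope_eq_zero (hn : 1 ≤ n) :
    ∃ c, 0 < c ∧ c < Real.arsinh n ∧ lowerSlope (2 / n) c = 0 := by
  have hn1 : (1 : ℝ) ≤ n := by exact_mod_cast hn
  have hk : (0 : ℝ) < 2 / n := by positivity
  -- Here `p / sinh p = 4p` exceeds `kp ≤ 2p`, and `kp / (e^{kp} - 1) ≤ 1`, so the slope is at least
  -- `2p`.
  set p := Real.arsinh (1 / 4) with hp
  have hp0 : 0 < p := Real.arsinh_pos_iff.2 (by norm_num)
  have hpn : p < Real.arsinh n := Real.arsinh_lt_arsinh.2 (by linarith)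
  have hpos : 0 < lowerSlope (2 / n) p := by
    have h1 := div_exp_sub_one_le_one (x := 2 / n * p) (by positivity)
    have h2 : 2 / n * p ≤ 2 * p := by
      gcongr
      exact div_le_self zero_le_two hn1
    rw [lowerSlope, hp, Real.sinh_arsinh, ← hp]
    linarith
  have hcont : ContinuousOn (lowerSlope (2 / n)) (Set.Icc p (Real.arsinh n)) :=
    (continuousOn_lowerSlope hk).mono fun x hx => hp0.trans_le hx.1
  obtain ⟨c, hc, hc0⟩ := intermediate_value_Icc' hpn.le hcont
    ⟨(lowerSlope_arsinh_neg hn).le, hpos.le⟩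
  refine ⟨c, hp0.trans_le hc.1, hc.2.lt_of_ne ?_, hc0⟩
  rintro rfl
  exact (lowerSlope_arsinh_neg hn).ne hc0

lemma exists_upperSlope_eq_zero (hn : 1 ≤ n) :
    ∃ c, Real.arsinh n < c ∧ upperSlope (2 / n) c = 0 := by
  have hn1 : (1 : ℝ) ≤ n := by exact_mod_cast hn
  have hn0 : (0 : ℝ) < n := by linarith
  have hk : (0 : ℝ) < 2 / n := by positivity
  have hu := arsinh_natCast_pos hn
  -- At `u = 4n` the product `ku` is `8` for every `n`, and quadratic lower bounds on `exp` suffice: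
  -- `1 - 2/3 - 1/5 > 0`.
  have hpos : 0 < upperSlope (2 / n) (4 * n) := by
    have e : 2 / n * (4 * n : ℝ) = 8 := by field_simp; norm_num
    have h1 : (8 : ℝ) / (Real.exp 8 - 1) ≤ 1 / 5 := by
      have := Real.quadratic_le_exp_of_nonneg (x := 8) (by norm_num)
      rw [div_le_div_iff₀ (by linarith) (by norm_num)]
      linarith
    have h2 : 4 * (n : ℝ) / Real.sinh (4 * n) ≤ 2 / 3 := by
      have h3 := Real.quadratic_le_exp_of_nonneg (x := 4 * n) (by positivity)
      have h4 : Real.exp (-(4 * n : ℝ)) ≤ 1 := Real.exp_le_one_iff.2 (by linarith)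
      have h5 : 6 * (n : ℝ) ≤ Real.sinh (4 * n) := by
        rw [Real.sinh_eq]
        nlinarith
      rw [div_le_div_iff₀ (by linarith) (by norm_num)]
      linarith
    rw [upperSlope, e]
    linarith
  have hlt : Real.arsinh n < 4 * n := by
    by_contra! h
    have := (strictMonoOn_upperSlope hk).monotoneOn (Set.mem_Ioi.2 (by positivity)) hu h
    linarith [upperSlope_arsinh_neg hn]
  have hcont : ContinuousOn (upperSlope (2 / n)) (Set.Icc (Real.arsinh n) (4 * n)) :=
    (continuousOn_upperSlope hk).mono fun x hx => hu.trans_le hx.1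
  obtain ⟨c, hc, hc0⟩ := intermediate_value_Icc hlt.le hcont
    ⟨(upperSlope_arsinh_neg hn).le, hpos.le⟩
  refine ⟨c, hc.1.lt_of_ne ?_, hc0⟩
  rintro rfl
  exact (upperSlope_arsinh_neg hn).ne hc0

lemma logLower_lt {k c u : ℝ} (hk : 0 < k) (hc : 0 < c) (hc0 : lowerSlope k c = 0) (hu : 0 < u)
    (huc : u ≠ c) : logLower k u < logLower k c :=
  lt_of_hasDerivAt_div (fun _ => hasDerivAt_logLower hk) (strictAntiOn_lowerSlope hk) hc hc0 hu huc

lemma lt_logUpper {k c u : ℝ} (hk : 0 < k) (hc : 0 < c) (hc0 : upperSlope k c = 0) (hu : 0 < u)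
    (huc : u ≠ c) : logUpper k c < logUpper k u := by
  have := lt_of_hasDerivAt_div (F := fun u => -logUpper k u) (ψ := fun u => -upperSlope k u)
    (fun u hu => (hasDerivAt_logUpper hk hu).neg.congr_deriv (neg_div _ _).symm)
    (strictMonoOn_upperSlope hk).neg hc (by simpa using hc0) hu huc
  linarith

/-- The logarithm of the condition number is minimal exactly at `arsinh n`. -/
lemma lt_logUpper_sub_logLower (hn : 1 ≤ n) {u : ℝ} (hu : 0 < u) (huc : u ≠ Real.arsinh n) :
    logUpper (2 / n) (Real.arsinh n) - logLower (2 / n) (Real.arsinh n) <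
      logUpper (2 / n) u - logLower (2 / n) u := by
  have hn0 : (0 : ℝ) < n := by exact_mod_cast hn
  have hk : (0 : ℝ) < 2 / n := by positivity
  have := lt_of_hasDerivAt_div (F := fun u => logLower (2 / n) u - logUpper (2 / n) u)
    (ψ := fun u => 2 * (u / Real.sinh u) - 2 * (u / n))
    (fun u hu => ((hasDerivAt_logLower hk hu).sub (hasDerivAt_logUpper hk hu)).congr_deriv (by
      rw [← sub_div, lowerSlope, upperSlope]
      ring))
    (fun u hu w hw huw => by
      have h1 := strictAntiOn_div_sinh hu hw huw
      have h2 : u / n < w / n := div_lt_div_of_pos_right huw hn0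
      simp only at h1 ⊢
      linarith)
    (arsinh_natCast_pos hn) (by rw [Real.sinh_arsinh]; ring) hu huc
  linarith

/-! ### From the variable `u` back to lattices -/

/-- A geometric sum whose numerator `1 - e^{-2u}` is factored so that one factor cancels against `(1
± e^{-u})²`, leaving `tanh(u/2)` or its inverse. -/
lemma expSum_eq (hγ : 0 < γ) (ha : 0 < a) (hn : 1 ≤ n) :
    expSum γ a n = (1 - Real.exp (-(γ * (n * a)))) * (1 + Real.exp (-(γ * (n * a)))) /
      (1 - Real.exp (-(2 / n * (γ * (n * a))))) := by
  have hn0 : (n : ℝ) ≠ 0 := by exact_mod_cast (by omega : n ≠ 0)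
  have e : 2 / n * (γ * (n * a)) = 2 * γ * a := by field_simp
  have hpos : 0 < 1 - Real.exp (-(2 * γ * a)) := one_sub_exp_neg_pos (by positivity)
  rw [e, eq_div_iff hpos.ne', expSum]
  have hterm : ∀ i : ℕ, Real.exp (-(2 * γ) * (i * a)) = Real.exp (-(2 * γ * a)) ^ i := fun i => by
    rw [← Real.exp_nat_mul]; congr 1; ring
  simp_rw [hterm]
  have hsq : Real.exp (-(2 * γ * a)) ^ n = Real.exp (-(γ * (n * a))) ^ 2 := by
    rw [← Real.exp_nat_mul, ← Real.exp_nat_mul]; congr 1; push_cast; ring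
  rw [geom_sum_mul_neg, hsq]
  ring

lemma exp_logTanhHalf {u : ℝ} (hu : 0 < u) :
    Real.exp (logTanhHalf u) = (1 - Real.exp (-u)) / (1 + Real.exp (-u)) := by
  rw [logTanhHalf, Real.exp_sub, Real.exp_log (one_sub_exp_neg_pos hu), Real.exp_log (by positivity)]

lemma lowerConst_eq (hγ : 0 < γ) (ha : 0 < a) (hn : 1 ≤ n) :
    lowerConst γ a n = 2 * Real.exp (logLower (2 / n) (γ * (n * a))) := by
  have hn0 : (0 : ℝ) < n := by exact_mod_cast hn
  have hu : 0 < γ * (n * a) := by positivity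
  have h1 := one_sub_exp_neg_pos hu
  have h2 : 0 < 1 - Real.exp (-(2 / n * (γ * (n * a)))) := one_sub_exp_neg_pos (by positivity)
  rw [lowerConst, weightSup, expSum_eq hγ ha hn, logLower, Real.exp_sub, Real.exp_sub,
    Real.exp_add, Real.exp_log hu, Real.exp_log h2, exp_logTanhHalf hu, div_eq_mul_inv _ (Real.exp _),
    ← Real.exp_neg, show -(2 * γ) * a = -(2 / n * (γ * (n * a))) by field_simp, neg_mul]
  field_simp

lemma upperConst_eq (hγ : 0 < γ) (ha : 0 < a) (hn : 1 ≤ n) :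
    upperConst γ a n = 2 * Real.exp (logUpper (2 / n) (γ * (n * a))) := by
  have hn0 : (0 : ℝ) < n := by exact_mod_cast hn
  have hu : 0 < γ * (n * a) := by positivity
  have h1 := one_sub_exp_neg_pos hu
  have h2 : 0 < 1 - Real.exp (-(2 / n * (γ * (n * a)))) := one_sub_exp_neg_pos (by positivity)
  rw [upperConst, weightSup, expSum_eq hγ ha hn, logUpper, Real.exp_sub, Real.exp_sub,
    Real.exp_log hu, Real.exp_log h2, exp_logTanhHalf hu, neg_mul]
  field_simp

lemma condNumber_oneSidedExp (hγ : 0 < γ) (ha : 0 < a) (hn : 1 ≤ n) :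
    condNumber (oneSidedExp γ) (rectLattice a (1 / (n * a))) =
      ENNReal.ofReal (Real.exp (logUpper (2 / n) (γ * (n * a)) -
        logLower (2 / n) (γ * (n * a)))) := by
  rw [condNumber, lowerFrameBound_oneSidedExp hγ ha hn, upperFrameBound_oneSidedExp hγ ha hn,
    lowerConst_eq hγ ha hn, upperConst_eq hγ ha hn, ← ENNReal.ofReal_div_of_pos (by positivity),
    Real.exp_sub, mul_div_mul_left _ _ two_ne_zero]

lemma eq_one_div_of_inv_mul_eq {b : ℝ} (ha : 0 < a) (hn : 1 ≤ n) (h : (a * b)⁻¹ = n) :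
    b = 1 / (n * a) := by
  have hn0 : (n : ℝ) ≠ 0 := by exact_mod_cast (by omega : n ≠ 0)
  have h1 : a * b = (n : ℝ)⁻¹ := by rw [← h, inv_inv]
  rw [one_div, mul_inv, ← h1]
  field_simp

lemma lowerConst_le_upperConst (hγ : 0 < γ) (ha : 0 < a) (hn : 1 ≤ n) :
    lowerConst γ a n ≤ upperConst γ a n := by
  have hw := weightSup_pos hγ ha hn
  have hρ1 := exp_neg_lt_one hγ ha hn
  have hρ0 := Real.exp_pos (-γ * (n * a))
  have hexp : Real.exp (-(2 * γ) * a) ≤ 1 := Real.exp_le_one_iff.2 (by nlinarith)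
  have hpos : 0 < 1 - Real.exp (-γ * (n * a)) := by linarith
  rw [lowerConst, upperConst]
  refine div_le_div₀ hw.le (mul_le_of_le_one_right hw.le hexp) (by positivity) ?_
  exact pow_le_pow_left₀ hpos.le (by linarith) 2

/-- If a lattice functional `V` depends on `u = γ n a` through `W`, and `W` has a strict extremum
at `c`, then `V` has a unique extremal rectangular lattice of density `n`. -/
lemma unique_extremal_lattice {α : Type*} [PartialOrder α] (hγ : 0 < γ) (hn : 1 ≤ n)
    {V : Set (ℝ × ℝ) → α} {W : ℝ → α}
    (hV : ∀ a, 0 < a → V (rectLattice a (1 / (n * a))) = W (γ * (n * a))) {c : ℝ} (hc : 0 < c)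
    (hW : ∀ u, 0 < u → u ≠ c → W u < W c) {a b : ℝ} (ha : 0 < a) (hab : (a * b)⁻¹ = (n : ℝ)) :
    V (rectLattice a b) ≤ V (rectLattice (c / γ / n) (1 / (c / γ))) ∧
      (V (rectLattice a b) = V (rectLattice (c / γ / n) (1 / (c / γ))) ↔
        a = c / γ / n ∧ b = 1 / (c / γ)) := by
  have hn0 : (0 : ℝ) < n := by exact_mod_cast hn
  have hb := eq_one_div_of_inv_mul_eq ha hn hab
  -- The time step `a = c / γ / n` is the one with `γ n a = c`.
  have hcV : V (rectLattice (c / γ / n) (1 / (c / γ))) = W c := by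
    have h := hV (c / γ / n) (by positivity)
    rwa [mul_div_cancel₀ _ hn0.ne', mul_div_cancel₀ _ hγ.ne'] at h
  rw [hcV, hb, hV a ha]
  by_cases hu : γ * (n * a) = c
  · have h1 : a = c / γ / n := by rw [← hu]; field_simp
    have h2 : 1 / (n * a) = 1 / (c / γ) := by rw [← hu]; field_simp
    exact ⟨hu ▸ le_rfl, fun _ => ⟨h1, h2⟩, fun _ => by rw [hu]⟩
  · have hlt := hW _ (by positivity) hu
    refine ⟨hlt.le, fun h => absurd h hlt.ne, fun h => absurd ?_ hu⟩
    rw [h.1]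
    field_simp

end Gabor

end

theorem theorem2p6 (γ : ℝ) (hγ : 0 < γ) (n : ℕ) (hn : 1 ≤ n) :
    -- every lattice of density `n` gives a frame, so all quantities below are positive and finite
    (∀ a b : ℝ, 0 < a → 0 < b → (a * b)⁻¹ = (n : ℝ) →
      Gabor.IsFrame (Gabor.oneSidedExp γ) (Gabor.rectLattice a b)) ∧
    -- the condition number
    (∀ a₀ : ℝ, a₀ = Real.arsinh (n : ℝ) / γ →
      ∀ a b : ℝ, 0 < a → 0 < b → (a * b)⁻¹ = (n : ℝ) →
        Gabor.condNumber (Gabor.oneSidedExp γ) (Gabor.rectLattice (a₀ / n) (1 / a₀)) ≤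
          Gabor.condNumber (Gabor.oneSidedExp γ) (Gabor.rectLattice a b) ∧
        (Gabor.condNumber (Gabor.oneSidedExp γ) (Gabor.rectLattice a b) =
          Gabor.condNumber (Gabor.oneSidedExp γ) (Gabor.rectLattice (a₀ / n) (1 / a₀)) ↔
            a = a₀ / n ∧ b = 1 / a₀)) ∧
    -- the lower frame bound
    (∃ aLow : ℝ, 0 < aLow ∧ aLow < Real.arsinh (n : ℝ) / γ ∧
      ∀ a b : ℝ, 0 < a → 0 < b → (a * b)⁻¹ = (n : ℝ) →
        Gabor.lowerFrameBound (Gabor.oneSidedExp γ) (Gabor.rectLattice a b) ≤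
          Gabor.lowerFrameBound (Gabor.oneSidedExp γ) (Gabor.rectLattice (aLow / n) (1 / aLow)) ∧
        (Gabor.lowerFrameBound (Gabor.oneSidedExp γ) (Gabor.rectLattice a b) =
          Gabor.lowerFrameBound (Gabor.oneSidedExp γ) (Gabor.rectLattice (aLow / n) (1 / aLow)) ↔
            a = aLow / n ∧ b = 1 / aLow)) ∧
    -- the upper frame bound
    (∃ aUp : ℝ, Real.arsinh (n : ℝ) / γ < aUp ∧
      ∀ a b : ℝ, 0 < a → 0 < b → (a * b)⁻¹ = (n : ℝ) →
        Gabor.upperFrameBound (Gabor.oneSidedExp γ) (Gabor.rectLattice (aUp / n) (1 / aUp)) ≤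
          Gabor.upperFrameBound (Gabor.oneSidedExp γ) (Gabor.rectLattice a b) ∧
        (Gabor.upperFrameBound (Gabor.oneSidedExp γ) (Gabor.rectLattice a b) =
          Gabor.upperFrameBound (Gabor.oneSidedExp γ) (Gabor.rectLattice (aUp / n) (1 / aUp)) ↔
            a = aUp / n ∧ b = 1 / aUp)) := by
  have hn0 : (0 : ℝ) < n := by exact_mod_cast hn
  have hk : (0 : ℝ) < 2 / n := by positivity
  refine ⟨fun a b ha hb hab => ?_, ?_, ?_, ?_⟩
  · rw [Gabor.eq_one_div_of_inv_mul_eq ha hn hab]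
    obtain ⟨hA, hB⟩ := Gabor.frameSum_bounds hγ ha hn
    refine ⟨_, _, ?_, ?_, ENNReal.ofReal_lt_top, hA, hB⟩
    · rw [Gabor.lowerConst_eq hγ ha hn, ENNReal.ofReal_pos]
      positivity
    · exact ENNReal.ofReal_le_ofReal (Gabor.lowerConst_le_upperConst hγ ha hn)
  · rintro _ rfl a b ha - hab
    -- Reversing the order turns the minimization into a maximization.
    have h := Gabor.unique_extremal_lattice (α := ENNRealᵒᵈ) hγ hn
      (V := fun Λ => OrderDual.toDual (Gabor.condNumber (Gabor.oneSidedExp γ) Λ))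
      (W := fun u => OrderDual.toDual (ENNReal.ofReal (Real.exp
        (Gabor.logUpper (2 / n) u - Gabor.logLower (2 / n) u))))
      (fun a ha => congrArg _ (Gabor.condNumber_oneSidedExp hγ ha hn))
      (Gabor.arsinh_natCast_pos hn)
      (fun u hu huc => OrderDual.toDual_lt_toDual.2 ((ENNReal.ofReal_lt_ofReal_iff (by positivity)).2
        (Real.exp_lt_exp.2 (Gabor.lt_logUpper_sub_logLower hn hu huc)))) ha hab
    exact h
  · obtain ⟨c, hc, hcn, hc0⟩ := Gabor.exists_lowerSlope_eq_zero hn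
    refine ⟨c / γ, by positivity, by gcongr, fun a b ha _ hab => ?_⟩
    exact Gabor.unique_extremal_lattice hγ hn
      (V := fun Λ => Gabor.lowerFrameBound (Gabor.oneSidedExp γ) Λ)
      (W := fun u => ENNReal.ofReal (2 * Real.exp (Gabor.logLower (2 / n) u)))
      (fun a ha => by rw [Gabor.lowerFrameBound_oneSidedExp hγ ha hn, Gabor.lowerConst_eq hγ ha hn])
      hc (fun u hu huc => (ENNReal.ofReal_lt_ofReal_iff (by positivity)).2
        (mul_lt_mul_of_pos_left (Real.exp_lt_exp.2 (Gabor.logLower_lt hk hc hc0 hu huc)) two_pos))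
      ha hab
  · obtain ⟨c, hcn, hc0⟩ := Gabor.exists_upperSlope_eq_zero hn
    have hc := (Gabor.arsinh_natCast_pos hn).trans hcn
    refine ⟨c / γ, by gcongr, fun a b ha _ hab => ?_⟩
    have h := Gabor.unique_extremal_lattice (α := ENNRealᵒᵈ) hγ hn
      (V := fun Λ => OrderDual.toDual (Gabor.upperFrameBound (Gabor.oneSidedExp γ) Λ))
      (W := fun u => OrderDual.toDual (ENNReal.ofReal (2 * Real.exp (Gabor.logUpper (2 / n) u))))
      (fun a ha => by rw [Gabor.upperFrameBound_oneSidedExp hγ ha hn, Gabor.upperConst_eq hγ ha hn])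
      hc (fun u hu huc => OrderDual.toDual_lt_toDual.2 ((ENNReal.ofReal_lt_ofReal_iff
        (by positivity)).2 (mul_lt_mul_of_pos_left
          (Real.exp_lt_exp.2 (Gabor.lt_logUpper hk hc hc0 hu huc)) two_pos))) ha hab
    exact h
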